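/- Let $\mathcal P$ be a compact topological space (for example a compact subset of $\mathbb R^p$, or a compact manifold). For every $\mu\in\mathcal P$ let $(X_\mu,\|\cdot\|_{X_\mu})$ and $(Y_\mu,\|\cdot\|_{Y_\mu})$ be real Banach spaces such that all $X_\mu$ are linear subspaces of one real vector space $V$ and all $Y_\mu$ are linear subspaces of one real vector space $W$ (for example spaces of (classes of) $\mathbb R^m$-valued functions on a bounded domain; no topology on $V$ or $W$ is needed). Let $b_\mu\colon X_\mu\times Y_\mu\to\mathbb R$ be continuous bilinear forms and $f_\mu\in Y_\mu'$. Assume that for each fixed $\mu$ the variational problem is well-posed: for every $g\in Y_\mu'$ there is exactly one $u\in X_\mu$ with $b_\mu(u,v)=g(v)$ for all $v\in Y_\mu$, and $\|u\|_{X_\mu}\le K_\mu\|g\|_{Y_\mu'}$ with $K_\mu$ independent of $g$. Let $\sigma_{\mathrm{sol}}(\mu)=u_\mu\in X_\mu$ be the solution of $$b_\mu(u_\mu,v)=f_\mu(v)\qquad\text{for all } v\in Y_\mu .$$ Put $X_0:=\bigcap_{\mu\in\mathcal P}X_\mu$ and $Y_0:=\bigcap_{\mu\in\mathcal P}Y_\mu$,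 and assume: 1. $X_0$ is dense in $X_\mu$ and $Y_0$ is dense in $Y_\mu$ for every $\mu\in\mathcal P$. 2. There are norms $\|\cdot\|_{X_0}$ on $X_0$ and $\|\cdot\|_{Y_0}$ on $Y_0$ and constants $c,C,\tilde c,\tilde C>0$, all independent of $\mu$, such that for all $\mu\in\mathcal P$ $$\tilde c\,\|u\|_{X_0}\le\|u\|_{X_\mu}\le\tilde C\,\|u\|_{X_0}\quad(u\in X_0),\qquad c\,\|v\|_{Y_0}\le\|v\|_{Y_\mu}\le C\,\|v\|_{Y_0}\quad(v\in Y_0).$$ 3. There are $Q_b\ge 1$, $Q_f\ge 0$, continuous functions $\theta^b_i,\theta^f_i\colon\mathcal P\to\mathbb R$, bilinear forms $b_i\colon X_0\times Y_0\to\mathbb R$ and linear forms $f_i\colon Y_0\to\mathbb R$, continuous with respect to $\|\cdot\|_{X_0}$ and $\|\cdot\|_{Y_0}$, such that for all $\mu\in\mathcal P$, $u\in X_0$, $v\in Y_0$ $$b_\mu(u,v)=\sum_{i=1}^{Q_b}\theta^b_i(\mu)\,b_i(u,v),\qquad f_\mu(v)=\sum_{i=1}^{Q_f}\theta^f_i(\mu)\,f_i(v).$$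 For $\varphi\in X_0$ let $\sigma_\varphi$ be the constant section $\sigma_\varphi(\mu)=\varphi\in X_\mu$, and let $\Gamma_{X_0}=\{\sigma_\varphi:\varphi\in X_0\}$. For $N\in\mathbb N$ define the Sectional Kolmogorov $N$-width of $\sigma_{\mathrm{sol}}$ with respect to $\Gamma_{X_0}$ by $$d_N^{\Gamma_{X_0}}(\sigma_{\mathrm{sol}}):=\inf_{\substack{\Gamma_N\subseteq\Gamma_{X_0}\text{ linear subspace}\\ \dim\Gamma_N\le N}}\ \sup_{\mu\in\mathcal P}\ \inf_{\sigma_N\in\Gamma_N}\ \|\sigma_{\mathrm{sol}}(\mu)-\sigma_N(\mu)\|_{X_\mu}.$$ Then there are constants $\alpha,\beta>0$, independent of $N$, such that for all $N\in\mathbb N=\{0,1,2,\dots\}$ $$d_N^{\Gamma_{X_0}}(\sigma_{\mathrm{sol}})\le\alpha\,\exp\!\left(-\beta N^{1/Q_b}\right).$$ -/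

import Mathlib

/-! Families of spaces `X μ`, `μ : P`, all of which are linear subspaces of one real vector space `V`,
are given by injective linear maps `ι μ : X μ → V`; every `X μ` carries its own norm. -/

/-- The intersection `X₀ = ⋂ μ, X μ`, as a linear subspace of `V`. -/
def intersectionSpace {P : Type*} {X : P → Type*} {V : Type*}
    [∀ μ, AddCommGroup (X μ)] [∀ μ, Module ℝ (X μ)] [AddCommGroup V] [Module ℝ V]
    (ι : ∀ μ, X μ →ₗ[ℝ] V) : Submodule ℝ V :=
  ⨅ μ, LinearMap.range (ι μ)

/-- The constant section `σ_φ(μ) = φ` of an element `φ` of the intersection, with `φ` regarded as an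
element of each space `X μ` (see `apply_constantSection`); linear in `φ`. -/
noncomputable def constantSection {P : Type*} {X : P → Type*} {V : Type*}
    [∀ μ, AddCommGroup (X μ)] [∀ μ, Module ℝ (X μ)] [AddCommGroup V] [Module ℝ V]
    (ι : ∀ μ, X μ →ₗ[ℝ] V) (hι : ∀ μ, Function.Injective (ι μ)) :
    intersectionSpace ι →ₗ[ℝ] (∀ μ, X μ) :=
  LinearMap.pi fun μ =>
    (LinearEquiv.ofInjective (ι μ) (hι μ)).symm.toLinearMap ∘ₗ
      Submodule.inclusion (iInf_le (fun ν => LinearMap.range (ι ν)) μ)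

theorem apply_constantSection {P : Type*} {X : P → Type*} {V : Type*}
    [∀ μ, AddCommGroup (X μ)] [∀ μ, Module ℝ (X μ)] [AddCommGroup V] [Module ℝ V]
    (ι : ∀ μ, X μ →ₗ[ℝ] V) (hι : ∀ μ, Function.Injective (ι μ))
    (φ : intersectionSpace ι) (μ : P) :
    ι μ (constantSection ι hι φ μ) = (φ : V) := by
  have h := (LinearEquiv.ofInjective (ι μ) (hι μ)).apply_symm_apply
    (Submodule.inclusion (iInf_le (fun ν => LinearMap.range (ι ν)) μ) φ)
  exact congrArg Subtype.val h

/-- The vector space `Γ_{X₀}` of constant sections. -/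
noncomputable def constantSections {P : Type*} {X : P → Type*} {V : Type*}
    [∀ μ, AddCommGroup (X μ)] [∀ μ, Module ℝ (X μ)] [AddCommGroup V] [Module ℝ V]
    (ι : ∀ μ, X μ →ₗ[ℝ] V) (hι : ∀ μ, Function.Injective (ι μ)) :
    Submodule ℝ (∀ μ, X μ) :=
  LinearMap.range (constantSection ι hι)

/-- The intersection space is dense in `X μ` for every parameter `μ`. -/
def DenseIntersection {P : Type*} {X : P → Type*} {V : Type*}
    [∀ μ, NormedAddCommGroup (X μ)] [∀ μ, NormedSpace ℝ (X μ)] [AddCommGroup V] [Module ℝ V]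
    (ι : ∀ μ, X μ →ₗ[ℝ] V) : Prop :=
  ∀ μ, Dense {x : X μ | ι μ x ∈ intersectionSpace ι}

/-- The Sectional Kolmogorov `N`-width of `σ` with respect to a vector space `Γ` of sections. -/
noncomputable def sectionalWidth {P : Type*} {X : P → Type*}
    [∀ μ, NormedAddCommGroup (X μ)] [∀ μ, NormedSpace ℝ (X μ)]
    (Γ : Submodule ℝ (∀ μ, X μ)) (N : ℕ) (σ : ∀ μ, X μ) : ENNReal :=
  ⨅ (ΓN : Submodule ℝ (∀ μ, X μ)) (_ : ΓN ≤ Γ) (_ : Module.rank ℝ ΓN ≤ N),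
    ⨆ μ, ⨅ τ ∈ ΓN, ‖σ μ - τ μ‖ₑ

/-- Well-posedness of the variational problem with bilinear form `b`: for every functional `g` on
the test space there is exactly one `u` with `b u v = g v` for all `v`, and it is stable in `g`. -/
def WellPosed {E F : Type*} [NormedAddCommGroup E] [NormedSpace ℝ E]
    [NormedAddCommGroup F] [NormedSpace ℝ F] (b : E →L[ℝ] F →L[ℝ] ℝ) : Prop :=
  (∀ g : F →L[ℝ] ℝ, ∃! u : E, ∀ v, b u v = g v) ∧
    ∃ K : ℝ, ∀ (g : F →L[ℝ] ℝ) (u : E), (∀ v, b u v = g v) → ‖u‖ ≤ K * ‖g‖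

/-! The norm equivalences identify every `X μ` with one Banach space, the completion E of X₀.
Testing against Y₀ turns the problem into B(μ) u = g(μ), where B(μ) = ∑ θᵢ(μ) Bᵢ maps E to the dual
of Y₀ and is an isomorphism by well-posedness and density (`WellPosed.exists_leftInverse`).

Near a fixed ν, B(ν)⁻¹B(μ) = 1 + D(μ) with ‖D(μ)‖ ≤ 1/2, so M terms of the Neumann series give an
error of order 2⁻ᴹ. This truncation is a polynomial in the Q_b numbers θᵢ(μ) - θᵢ(ν), of degree
below M in each, so it stays in a μ-independent space of dimension at most Q_f M^Q_b
(`exists_local_approximation`).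

By compactness finitely many ν suffice, and density moves the sum of their spaces into X₀
(`exists_approximation`). With M of order N^(1/Q_b), the error 2⁻ᴹ becomes the claimed rate. -/

open Topology UniformSpace

/-! ### Truncated Neumann series -/

/-- The partial sums `1 - D + D² - ⋯` of the Neumann series of `1 + D`. -/
def neumannSum {A : Type*} [Ring A] (D : A) : ℕ → A
  | 0 => 0
  | M + 1 => 1 - D * neumannSum D M

/-- The Neumann sums of `∑ i, δ i • R i` are polynomials in `δ` of degree less than `M`
in every variable. -/
theorem exists_neumannSum_eq_sum_monomial {A ι : Type*} [Ring A] [Algebra ℝ A] [Fintype ι]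
    [DecidableEq ι] (R : ι → A) (M : ℕ) :
    ∃ c : (ι → ℕ) → A, ∀ δ : ι → ℝ, neumannSum (∑ i, δ i • R i) M =
      ∑ m ∈ Fintype.piFinset fun _ : ι => Finset.range M, (∏ i, δ i ^ m i) • c m := by
  induction M with
  | zero =>
    -- The index box for `M = 0` is empty, except that for empty `ι` it holds one multi-index; zero
    -- coefficients serve both cases.
    cases isEmpty_or_nonempty ι
    · exact ⟨fun _ => 0, fun δ => by simp [neumannSum]⟩
    · exact ⟨fun _ => 0, fun δ => by simp [neumannSum]⟩
  | succ M ih =>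
    obtain ⟨c, hc⟩ := ih
    let box : ℕ → Finset (ι → ℕ) := fun M => Fintype.piFinset fun _ => Finset.range M
    let g : ι × (ι → ℕ) → (ι → ℕ) := fun p => p.2 + Pi.single p.1 1
    -- Multiplication by `∑ i, δ i • R i` shifts a multi-index by a unit vector. Several pairs reach
    -- the same `m`, so its coefficient collects the fibre of `g`; the `R i` need not commute.
    refine ⟨fun m => (if m = 0 then 1 else 0) -
      ∑ p ∈ (Finset.univ ×ˢ box M) with g p = m, R p.1 * c p.2, fun δ => ?_⟩
    have hg : ∀ p ∈ Finset.univ ×ˢ box M, g p ∈ box (M + 1) := by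
      intro p hp
      simp only [box, Finset.mem_product, Fintype.mem_piFinset, Finset.mem_range] at hp ⊢
      intro i
      have h1 := hp.2 i
      by_cases h : i = p.1
      · subst h; simp [g, h1]
      · simp [g, Pi.single_eq_of_ne h]; omega
    have hmon : ∀ p : ι × (ι → ℕ), ∏ i, δ i ^ g p i = δ p.1 * ∏ i, δ i ^ p.2 i := by
      intro p
      simp only [g, Pi.add_apply, pow_add, Finset.prod_mul_distrib]
      rw [mul_comm]
      congr 1
      rw [Finset.prod_eq_single p.1] <;> simp +contextual [Pi.single_eq_of_ne]
    have h0 : (0 : ι → ℕ) ∈ box (M + 1) := by simp [box]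
    change _ = ∑ m ∈ box (M + 1), _
    simp only [smul_sub, Finset.sum_sub_distrib]
    rw [neumannSum, hc]
    congr 1
    · rw [Finset.sum_eq_single_of_mem 0 h0 (fun m _ hm => by simp [hm])]
      simp
    · rw [Finset.sum_mul_sum, ← Finset.sum_product', ← Finset.sum_fiberwise_of_maps_to hg]
      refine Finset.sum_congr rfl fun m _ => ?_
      rw [Finset.smul_sum]
      refine Finset.sum_congr rfl fun p hp => ?_
      rw [← (Finset.mem_filter.1 hp).2, hmon, smul_mul_smul_comm]

/-- If `u + D u = x` with `‖D‖ ≤ 1/2`, the Neumann sums approximate `u` geometrically. -/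
theorem norm_sub_neumannSum_le {E : Type*} [NormedAddCommGroup E] [NormedSpace ℝ E]
    {D : E →L[ℝ] E} (hD : ‖D‖ ≤ 1 / 2) {u x : E} (h : u + D u = x) (M : ℕ) :
    ‖u - neumannSum D M x‖ ≤ ‖u‖ * (1 / 2) ^ M := by
  induction M with
  | zero => simp [neumannSum]
  | succ M ih =>
    -- Both `u = x - D u` and the recursion have the same form, so each step multiplies the error by
    -- `-D`; it starts at `u`.
    have : u - neumannSum D (M + 1) x = -D (u - neumannSum D M x) := by
      simp only [neumannSum, sub_apply, one_apply_eq_self, map_sub, ← h]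
      abel
    rw [this, norm_neg]
    calc _ ≤ ‖D‖ * ‖u - neumannSum D M x‖ := D.le_opNorm _
      _ ≤ 1 / 2 * (‖u‖ * (1 / 2) ^ M) := by gcongr
      _ = _ := by ring

/-! ### Approximation in a fixed space -/

/-- Near a parameter `ν`, the solutions of an affinely parametrized linear equation are
approximated at a geometric rate by subspaces of polynomially growing dimension. -/
theorem exists_local_approximation {P E G : Type*} [TopologicalSpace P]
    [NormedAddCommGroup E] [NormedSpace ℝ E] [NormedAddCommGroup G] [NormedSpace ℝ G]
    {ι κ : Type*} [Fintype ι] [Fintype κ]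
    {θ : ι → P → ℝ} (hθ : ∀ i, Continuous (θ i)) {η : κ → P → ℝ} (hη : ∀ l, Continuous (η l))
    (B : ι → E →L[ℝ] G) (g : κ → G) (u : P → E)
    (hu : ∀ μ, ∑ i, θ i μ • B i (u μ) = ∑ l, η l μ • g l)
    (ν : P) (A : G →L[ℝ] E) (hA : ∀ x, A (∑ i, θ i ν • B i x) = x) :
    ∃ C : ℝ, ∃ U ∈ 𝓝 ν, (∀ μ ∈ U, ‖u μ‖ ≤ C) ∧ ∀ M : ℕ, ∃ T : Finset E,
      T.card ≤ Fintype.card κ * M ^ Fintype.card ι ∧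
      ∀ μ ∈ U, ∃ s ∈ Submodule.span ℝ (T : Set E), ‖u μ - s‖ ≤ C * (1 / 2) ^ M := by
  classical
  -- Since `A` is a left inverse of the operator at `ν`, composing it with the operator at `μ` gives
  -- `1 + D μ`, and `D` vanishes at `ν`.
  let D : P → E →L[ℝ] E := fun μ => ∑ i, (θ i μ - θ i ν) • (A ∘L B i)
  let x : P → E := fun μ => ∑ l, η l μ • A (g l)
  have hDc : Continuous D := by fun_prop
  have hxc : Continuous x := by fun_prop
  have hD0 : D ν = 0 := by simp [D]
  have heq : ∀ μ, u μ + D μ (u μ) = x μ := by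
    intro μ
    have h1 := congrArg A (hu μ)
    have h2 := hA (u μ)
    simp only [map_sum, map_smul] at h1 h2
    simp only [x, D, ← h1, sum_apply, smul_apply, sub_smul, sub_apply,
      Finset.sum_sub_distrib, ContinuousLinearMap.comp_apply, h2]
    abel
  have hU1 : ∀ᶠ μ in 𝓝 ν, ‖D μ‖ < 1 / 2 :=
    hDc.norm.continuousAt.eventually_lt continuousAt_const (by simp [hD0])
  have hU2 : ∀ᶠ μ in 𝓝 ν, ‖x μ‖ < ‖x ν‖ + 1 :=
    hxc.norm.continuousAt.eventually_lt continuousAt_const (by simp)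
  have hbd : ∀ μ, ‖D μ‖ < 1 / 2 → ‖x μ‖ < ‖x ν‖ + 1 → ‖u μ‖ ≤ 2 * (‖x ν‖ + 1) := by
    intro μ h1 h2
    have h3 : ‖u μ‖ ≤ ‖x μ‖ + ‖D μ (u μ)‖ := by
      rw [eq_sub_of_add_eq (heq μ)]; exact norm_sub_le _ _ |>.trans (by rw [← eq_sub_of_add_eq (heq μ)])
    have h4 : ‖D μ (u μ)‖ ≤ 1 / 2 * ‖u μ‖ := (D μ).le_of_opNorm_le h1.le _
    linarith
  refine ⟨2 * (‖x ν‖ + 1), _, hU1.and hU2, fun μ h => hbd μ h.1 h.2, fun M => ?_⟩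
  obtain ⟨c, hc⟩ := exists_neumannSum_eq_sum_monomial (fun i => A ∘L B i) M
  let I : Finset (κ × (ι → ℕ)) := Finset.univ ×ˢ Fintype.piFinset fun _ => Finset.range M
  -- The parameter enters the truncated series only through scalars; the vectors `c m (A (g l))` are
  -- the same for all `μ`.
  refine ⟨I.image fun p => c p.2 (A (g p.1)), Finset.card_image_le.trans ?_, fun μ h => ?_⟩
  · simp [I]
  · refine ⟨neumannSum (D μ) M (x μ), ?_,
      (norm_sub_neumannSum_le h.1.le (heq μ) M).trans ?_⟩
    · simp only [D, hc, x, map_sum, map_smul, sum_apply, smul_apply]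
      refine sum_mem fun l _ => Submodule.smul_mem _ _ (sum_mem fun m hm => Submodule.smul_mem _ _ ?_)
      refine Submodule.subset_span ?_
      exact Finset.mem_coe.2 (Finset.mem_image.2 ⟨(l, m), by simpa [I] using hm, rfl⟩)
    · gcongr
      exact hbd μ h.1 h.2

/-- A finite-dimensional subspace can be mapped into a dense subspace by a linear map that is
uniformly close to the identity. -/
theorem exists_linearMap_norm_sub_le {E₀ E : Type*} [AddCommGroup E₀] [Module ℝ E₀]
    [NormedAddCommGroup E] [NormedSpace ℝ E] (e : E₀ →ₗ[ℝ] E) (he : DenseRange e)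
    (S : Submodule ℝ E) [FiniteDimensional ℝ S] {ε : ℝ} (hε : 0 < ε) :
    ∃ L : S →ₗ[ℝ] E₀, ∀ s : S, ‖(s : E) - e (L s)‖ ≤ ε * ‖s‖ := by
  let b := Module.finBasis ℝ S
  -- Moving each basis vector by at most `ε / (K + 1)` moves `s` by at most `ε * ‖s‖`; the `+ 1`
  -- keeps the denominator positive.
  let K := ∑ i, ‖(LinearMap.toContinuousLinearMap (b.coord i) : S →L[ℝ] ℝ)‖
  have hK : 0 ≤ K := by positivity
  have hδ : 0 < ε / (K + 1) := by positivity
  choose a ha using fun i => he.exists_dist_lt (b i : E) hδ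
  refine ⟨b.constr ℝ a, fun s => ?_⟩
  have h1 : (s : E) - e (b.constr ℝ a s) = ∑ i, b.coord i s • ((b i : E) - e (a i)) := by
    have h2 : (s : E) = ∑ i, b.repr s i • (b i : E) := by
      conv_lhs => rw [← b.sum_repr s]
      simp only [Submodule.coe_sum, Submodule.coe_smul]
    simp [smul_sub, ← h2]
  rw [h1]
  calc _ ≤ ∑ i, ‖(LinearMap.toContinuousLinearMap (b.coord i) : S →L[ℝ] ℝ)‖ * ‖s‖ *
          (ε / (K + 1)) := by
        refine norm_sum_le_of_le _ fun i _ => ?_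
        rw [norm_smul]
        gcongr
        · exact (LinearMap.toContinuousLinearMap (b.coord i) : S →L[ℝ] ℝ).le_opNorm s
        · rw [← dist_eq_norm]; exact (ha i).le
    _ = K / (K + 1) * (ε * ‖s‖) := by
        rw [← Finset.sum_mul, ← Finset.sum_mul]; simp only [K]; ring
    _ ≤ 1 * (ε * ‖s‖) := by
        gcongr
        exact (div_le_one (by positivity)).2 (by linarith)
    _ = _ := one_mul _

/-- The solutions of a parameter-separable linear equation over a compact parameter space are
approximated at a geometric rate by subspaces of polynomially growing dimension, which may be
chosen inside a given dense subspace. -/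
theorem exists_approximation {P E₀ E G : Type*} [TopologicalSpace P] [CompactSpace P]
    [AddCommGroup E₀] [Module ℝ E₀]
    [NormedAddCommGroup E] [NormedSpace ℝ E] [NormedAddCommGroup G] [NormedSpace ℝ G]
    {ι κ : Type*} [Fintype ι] [Fintype κ]
    {θ : ι → P → ℝ} (hθ : ∀ i, Continuous (θ i)) {η : κ → P → ℝ} (hη : ∀ l, Continuous (η l))
    (B : ι → E →L[ℝ] G) (g : κ → G) (u : P → E)
    (hu : ∀ μ, ∑ i, θ i μ • B i (u μ) = ∑ l, η l μ • g l)
    (hA : ∀ ν, ∃ A : G →L[ℝ] E, ∀ x, A (∑ i, θ i ν • B i x) = x)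
    (e : E₀ →ₗ[ℝ] E) (he : DenseRange e) :
    ∃ (J : ℕ) (C : ℝ), 0 < J ∧ 0 < C ∧ ∀ M : ℕ, ∃ S : Submodule ℝ E₀,
      Module.rank ℝ S ≤ ((J * M ^ Fintype.card ι : ℕ) : Cardinal) ∧
      ∀ μ, ∃ s ∈ S, ‖u μ - e s‖ ≤ C * (1 / 2) ^ M := by
  classical
  choose A hA using hA
  choose C U hU hUC T hT hTU using fun ν =>
    exists_local_approximation hθ hη B g u hu ν (A ν) (hA ν)
  obtain ⟨t, ht⟩ := isCompact_univ.elim_nhds_subcover U fun ν _ => hU ν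
  have ht' : ∀ μ, ∃ ν ∈ t, μ ∈ U ν := fun μ => by simpa using ht.2 (Set.mem_univ μ)
  obtain ⟨C', hC'0, hC'⟩ : ∃ C' : ℝ, 0 < C' ∧ ∀ ν ∈ t, C ν ≤ C' := by
    refine ⟨∑ ν ∈ t, |C ν| + 1, by positivity, fun ν hν => ?_⟩
    have := Finset.single_le_sum (f := fun ν => |C ν|) (fun _ _ => abs_nonneg _) hν
    linarith [le_abs_self (C ν)]
  -- The `+ 1` makes `J` positive even if `t` or `κ` is empty. In the error, `C'` is the truncation
  -- and `2 * C'` the cost of moving into `E₀`: the approximants have norm at most `2 * C'`, and the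
  -- relative tolerance is `(1 / 2) ^ M`.
  refine ⟨t.card * Fintype.card κ + 1, C' + 2 * C', by omega, by positivity, fun M => ?_⟩
  let T' : Finset E := t.biUnion fun ν => T ν M
  have hT' : T'.card ≤ (t.card * Fintype.card κ + 1) * M ^ Fintype.card ι :=
    calc T'.card ≤ t.card * (Fintype.card κ * M ^ Fintype.card ι) :=
          Finset.card_biUnion_le_card_mul _ _ _ fun ν _ => hT ν M
      _ ≤ _ := by rw [← mul_assoc]; gcongr; omega
  obtain ⟨L, hL⟩ := exists_linearMap_norm_sub_le e he (Submodule.span ℝ (T' : Set E))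
    (ε := (1 / 2) ^ M) (by positivity)
  refine ⟨LinearMap.range L, ?_, fun μ => ?_⟩
  · rw [← Module.finrank_eq_rank, Nat.cast_le]
    exact (LinearMap.finrank_range_le L).trans ((finrank_span_finset_le_card T').trans hT')
  · obtain ⟨ν, hν, hμ⟩ := ht' μ
    obtain ⟨s, hs, hsu⟩ := hTU ν M μ hμ
    have hs' : s ∈ Submodule.span ℝ (T' : Set E) :=
      Submodule.span_mono (Finset.coe_subset.2 (Finset.subset_biUnion_of_mem (fun ν => T ν M) hν)) hs
    refine ⟨L ⟨s, hs'⟩, LinearMap.mem_range_self _ _, ?_⟩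
    have h1 : ‖u μ - s‖ ≤ C' * (1 / 2) ^ M := hsu.trans (by gcongr; exact hC' ν hν)
    have h2 : ‖s‖ ≤ 2 * C' := by
      have h3 : ‖s‖ ≤ ‖u μ‖ + ‖u μ - s‖ := by
        simpa using norm_sub_le (u μ) (u μ - s)
      have h4 : C' * (1 / 2) ^ M ≤ C' * 1 := by
        gcongr; exact pow_le_one₀ (by norm_num) (by norm_num)
      linarith [hUC ν μ hμ, hC' ν hν]
    calc ‖u μ - e (L ⟨s, hs'⟩)‖ = ‖(u μ - s) + (s - e (L ⟨s, hs'⟩))‖ := by congr 1; abel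
      _ ≤ C' * (1 / 2) ^ M + (1 / 2) ^ M * (2 * C') :=
          norm_add_le_of_le h1 ((hL ⟨s, hs'⟩).trans (by gcongr; exact h2))
      _ = _ := by ring

/-! ### From polynomial dimension to the exponential rate -/

/-- Geometric decay in `M` along dimensions `J * M ^ Q` is exponential decay in `N ^ (1 / Q)`. -/
theorem exists_mul_pow_le_and_half_pow_le {Q J : ℕ} (hQ : 1 ≤ Q) (hJ : 0 < J) :
    ∃ β : ℝ, 0 < β ∧ ∀ N : ℕ, ∃ M : ℕ, J * M ^ Q ≤ N ∧
      (1 / 2 : ℝ) ^ M ≤ 2 * Real.exp (-β * (N : ℝ) ^ (1 / (Q : ℝ))) := by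
  have hQ0 : (Q : ℝ) ≠ 0 := by positivity
  have hJ' : (0 : ℝ) < J := by positivity
  -- The choice is `M = ⌊y⌋₊` with `y = (N / J) ^ (1 / Q)`, so that `2⁻ʸ` is exactly the
  -- exponential; the factor 2 in the bound pays for rounding down.
  refine ⟨Real.log 2 / (J : ℝ) ^ (1 / (Q : ℝ)),
    div_pos (Real.log_pos (by norm_num)) (by positivity), fun N => ?_⟩
  let y : ℝ := (N / J : ℝ) ^ (1 / (Q : ℝ))
  have hy : 0 ≤ y := by positivity
  refine ⟨⌊y⌋₊, ?_, ?_⟩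
  · have h1 : ((⌊y⌋₊ : ℕ) : ℝ) ^ Q ≤ N / J := by
      calc _ ≤ y ^ Q := by gcongr; exact Nat.floor_le hy
        _ = N / J := by
          simp only [y]
          rw [← Real.rpow_natCast, ← Real.rpow_mul (by positivity), one_div_mul_cancel hQ0,
            Real.rpow_one]
    rw [le_div_iff₀ hJ'] at h1
    rw [mul_comm]
    exact_mod_cast h1
  · have h2 : -(Real.log 2 / (J : ℝ) ^ (1 / (Q : ℝ))) * (N : ℝ) ^ (1 / (Q : ℝ)) =
        -(Real.log 2 * y) := by
      simp only [y]; rw [Real.div_rpow (by positivity) (by positivity)]; ring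
    have h3 : (1 / 2 : ℝ) ^ ⌊y⌋₊ = Real.exp (-(Real.log 2 * ⌊y⌋₊)) := by
      rw [Real.exp_neg, mul_comm, Real.exp_nat_mul, Real.exp_log (by norm_num)]; simp
    have h4 : (2 : ℝ) * Real.exp (-(Real.log 2 * y)) =
        Real.exp (Real.log 2 + -(Real.log 2 * y)) := by
      rw [Real.exp_add, Real.exp_log (by norm_num)]
    rw [h2, h3, h4, Real.exp_le_exp]
    nlinarith [Real.log_pos (by norm_num : (1 : ℝ) < 2), Nat.lt_floor_add_one y]

/-! ### Reduction of well-posed problems to one Banach space -/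

/-- A linear map bounded by the norm pulled back along a map with dense range extends along it. -/
theorem exists_extension_of_denseRange {E₀ E F : Type*} [AddCommGroup E₀] [Module ℝ E₀]
    [NormedAddCommGroup E] [NormedSpace ℝ E] [NormedAddCommGroup F] [NormedSpace ℝ F]
    [CompleteSpace F] (e : E₀ →ₗ[ℝ] E) (he : DenseRange e) (φ : E₀ →ₗ[ℝ] F)
    (hφ : ∃ C : ℝ, ∀ x, ‖φ x‖ ≤ C * ‖e x‖) : ∃ ψ : E →L[ℝ] F, ∀ x, ψ (e x) = φ x :=
  ⟨φ.extendOfNorm e, fun x => LinearMap.extendOfNorm_eq he hφ x⟩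

/-- A well-posed problem, pulled back along an isomorphism of the trial spaces and a dense
embedding of the test spaces, has a continuous solution operator. -/
theorem WellPosed.exists_leftInverse {E E' F F₀ : Type*}
    [NormedAddCommGroup E] [NormedSpace ℝ E] [NormedAddCommGroup E'] [NormedSpace ℝ E']
    [CompleteSpace E'] [NormedAddCommGroup F] [NormedSpace ℝ F]
    [NormedAddCommGroup F₀] [NormedSpace ℝ F₀] {b : E →L[ℝ] F →L[ℝ] ℝ} (h : WellPosed b)
    (j : E' ≃L[ℝ] E) (k : F₀ →L[ℝ] F) (hk : DenseRange k) {c : ℝ} (hc : 0 < c)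
    (hck : ∀ v, c * ‖v‖ ≤ ‖k v‖) (B : E' →L[ℝ] F₀ →L[ℝ] ℝ)
    (hB : ∀ u v, B u v = b (j u) (k v)) :
    ∃ A : (F₀ →L[ℝ] ℝ) →L[ℝ] E', ∀ u, A (B u) = u := by
  -- If `B u = 0`, then `b (j u)` vanishes on a dense set, hence everywhere, and uniqueness for zero
  -- data applies.
  have hinj : B.ker = ⊥ := by
    refine LinearMap.ker_eq_bot'.2 fun u hu => ?_
    have h0 : ∀ v, b (j u) v = 0 := fun v => by
      refine hk.induction_on (p := fun v => b (j u) v = 0) v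
        (isClosed_eq (by fun_prop) (by fun_prop)) fun v => ?_
      rw [← hB]
      exact congrArg (fun g : F₀ →L[ℝ] ℝ => g v) hu
    have := (h.1 0).unique (y₁ := j u) (y₂ := 0) (by simpa using h0) (by simp)
    simpa using this
  -- The lower bound on `‖k v‖` lets a functional on `F₀` extend to `F`, where the problem is
  -- solvable.
  have hsurj : B.range = ⊤ := by
    refine LinearMap.range_eq_top.2 fun g => ?_
    obtain ⟨g', hg'⟩ := exists_extension_of_denseRange (k : F₀ →ₗ[ℝ] F) hk (g : F₀ →ₗ[ℝ] ℝ)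
      ⟨‖g‖ / c, fun v => by
        refine (g.le_opNorm v).trans ?_
        rw [div_mul_eq_mul_div, mul_div_assoc]
        gcongr
        rw [le_div_iff₀ hc, mul_comm]
        exact hck v⟩
    obtain ⟨u, hu, -⟩ := h.1 g'
    refine ⟨j.symm u, ?_⟩
    ext v
    have : B (j.symm u) v = g v := by
      rw [hB, j.apply_symm_apply, hu]
      exact hg' v
    exact this
  -- The inverse is continuous by the open mapping theorem, as `E'` and the dual of `F₀` are Banach
  -- spaces.
  exact ⟨(ContinuousLinearEquiv.ofBijective B hinj hsurj).symm, fun u =>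
    ContinuousLinearEquiv.ofBijective_symm_apply_apply B hinj hsurj u⟩

/-- The solutions of a parameter-separable family of well-posed problems, posed on completions of
fixed spaces `E₀` and `F₀` under uniformly equivalent norms, are approximated at a geometric rate
by subspaces of `E₀` of polynomially growing dimension. -/
theorem exists_approximation_of_wellPosed {P E₀ F₀ : Type*} {X Y : P → Type*}
    [TopologicalSpace P] [CompactSpace P]
    [NormedAddCommGroup E₀] [NormedSpace ℝ E₀] [NormedAddCommGroup F₀] [NormedSpace ℝ F₀]
    [∀ μ, NormedAddCommGroup (X μ)] [∀ μ, NormedSpace ℝ (X μ)] [∀ μ, CompleteSpace (X μ)]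
    [∀ μ, NormedAddCommGroup (Y μ)] [∀ μ, NormedSpace ℝ (Y μ)]
    (j : ∀ μ, E₀ →ₗ[ℝ] X μ) (hj : ∀ μ, DenseRange (j μ))
    {cX CX : ℝ} (hcX : 0 < cX) (hCX : 0 < CX)
    (hjX : ∀ μ u, cX * ‖u‖ ≤ ‖j μ u‖ ∧ ‖j μ u‖ ≤ CX * ‖u‖)
    (k : ∀ μ, F₀ →ₗ[ℝ] Y μ) (hk : ∀ μ, DenseRange (k μ))
    {cY CY : ℝ} (hcY : 0 < cY)
    (hkY : ∀ μ v, cY * ‖v‖ ≤ ‖k μ v‖ ∧ ‖k μ v‖ ≤ CY * ‖v‖)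
    (b : ∀ μ, X μ →L[ℝ] Y μ →L[ℝ] ℝ) (f : ∀ μ, Y μ →L[ℝ] ℝ) (hwp : ∀ μ, WellPosed (b μ))
    (σ : ∀ μ, X μ) (hσ : ∀ μ v, b μ (σ μ) v = f μ v)
    {ι κ : Type*} [Fintype ι] [Fintype κ]
    {θ : ι → P → ℝ} (hθ : ∀ i, Continuous (θ i)) {η : κ → P → ℝ} (hη : ∀ l, Continuous (η l))
    (b₀ : ι → E₀ →ₗ[ℝ] F₀ →ₗ[ℝ] ℝ) (hb₀ : ∀ i, ∃ K : ℝ, ∀ u v, |b₀ i u v| ≤ K * ‖u‖ * ‖v‖)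
    (f₀ : κ → F₀ →ₗ[ℝ] ℝ) (hf₀ : ∀ l, ∃ K : ℝ, ∀ v, |f₀ l v| ≤ K * ‖v‖)
    (hb : ∀ μ u v, b μ (j μ u) (k μ v) = ∑ i, θ i μ * b₀ i u v)
    (hf : ∀ μ v, f μ (k μ v) = ∑ l, η l μ * f₀ l v) :
    ∃ (J : ℕ) (C : ℝ), 0 < J ∧ 0 < C ∧ ∀ M : ℕ, ∃ S : Submodule ℝ E₀,
      Module.rank ℝ S ≤ ((J * M ^ Fintype.card ι : ℕ) : Cardinal) ∧
      ∀ μ, ∃ s ∈ S, ‖σ μ - j μ s‖ ≤ C * (1 / 2) ^ M := by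
  let e : E₀ →ₗ[ℝ] Completion E₀ := (Completion.toComplL : E₀ →L[ℝ] Completion E₀)
  have he : DenseRange e := Completion.denseRange_coe
  have hen : ∀ x, ‖e x‖ = ‖x‖ := fun x => Completion.norm_coe x
  have hj1 : ∀ μ x, ‖j μ (LinearEquiv.refl ℝ E₀ x)‖ ≤ CX * ‖e x‖ := fun μ x => by
    rw [hen]; exact (hjX μ x).2
  have hj2 : ∀ μ x, ‖e ((LinearEquiv.refl ℝ E₀).symm x)‖ ≤ cX⁻¹ * ‖j μ x‖ := fun μ x => by
    rw [hen, inv_mul_eq_div, le_div_iff₀ hcX, mul_comm]; exact (hjX μ x).1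
  -- Equivalent norms and dense ranges on both sides let the identity of `E₀` extend to an
  -- isomorphism from the completion onto `X μ`.
  let jh : ∀ μ, Completion E₀ ≃L[ℝ] X μ := fun μ =>
    (LinearEquiv.refl ℝ E₀).extend e (j μ) he ⟨CX, hj1 μ⟩ (hj μ) ⟨cX⁻¹, hj2 μ⟩
  have hjh : ∀ μ x, jh μ (e x) = j μ x := fun μ x => LinearEquiv.extend_eq _ _ _ _ _ _ _ x
  have hjn : ∀ μ x, ‖jh μ x‖ ≤ CX * ‖x‖ := fun μ x =>
    LinearEquiv.norm_extend_le _ _ _ CX he (hj1 μ) (hj μ) ⟨cX⁻¹, hj2 μ⟩ x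
  let kc : ∀ μ, F₀ →L[ℝ] Y μ := fun μ => (k μ).mkContinuous CY fun v => (hkY μ v).2
  choose K hK using hb₀
  choose K' hK' using hf₀
  -- Only the trial space needs completing: the values lie in the dual of `F₀`, which is complete
  -- whether or not `F₀` is.
  have hB : ∀ i, ∃ B : Completion E₀ →L[ℝ] F₀ →L[ℝ] ℝ, ∀ u v, B (e u) v = b₀ i u v := fun i => by
    let β := (b₀ i).mkContinuous₂ (K i) (hK i)
    obtain ⟨B, hB⟩ := exists_extension_of_denseRange e he (β : E₀ →ₗ[ℝ] F₀ →L[ℝ] ℝ)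
      ⟨‖β‖, fun x => by rw [hen]; exact β.le_opNorm x⟩
    exact ⟨B, fun u v => by rw [hB]; rfl⟩
  choose B hB using hB
  let g : κ → F₀ →L[ℝ] ℝ := fun l => (f₀ l).mkContinuous (K' l) (hK' l)
  -- Separability is given on `E₀` only; both sides are continuous in `x`, so it passes to the
  -- completion.
  have hBb : ∀ μ x v, (∑ i, θ i μ • B i) x v = b μ (jh μ x) (kc μ v) := fun μ x v => by
    refine he.induction_on
      (p := fun x => (∑ i, θ i μ • B i) x v = b μ (jh μ x) (kc μ v)) x
      (isClosed_eq (by fun_prop) (by fun_prop)) fun x => ?_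
    rw [hjh]
    refine Eq.trans ?_ (hb μ x v).symm
    simp [hB]
  obtain ⟨J, C, hJ, hC, h⟩ := exists_approximation hθ hη B g (fun μ => (jh μ).symm (σ μ))
    (fun μ => by
      ext v
      have h1 := hBb μ ((jh μ).symm (σ μ)) v
      rw [(jh μ).apply_symm_apply, hσ] at h1
      have h2 : f μ (kc μ v) = _ := hf μ v
      rw [h2] at h1
      simpa [g] using h1)
    (fun ν => by
      obtain ⟨A, hA⟩ := (hwp ν).exists_leftInverse (jh ν) (kc ν) (hk ν) hcY
        (fun v => (hkY ν v).1) (∑ i, θ i ν • B i) (hBb ν)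
      exact ⟨A, fun x => by simpa using hA x⟩) e he
  refine ⟨J, CX * C, hJ, by positivity, fun M => ?_⟩
  obtain ⟨S, hS, hS'⟩ := h M
  refine ⟨S, hS, fun μ => ?_⟩
  obtain ⟨s, hs, hs'⟩ := hS' μ
  refine ⟨s, hs, ?_⟩
  calc ‖σ μ - j μ s‖ = ‖jh μ ((jh μ).symm (σ μ) - e s)‖ := by
        rw [map_sub, (jh μ).apply_symm_apply, hjh]
    _ ≤ CX * (C * (1 / 2) ^ M) := (hjn μ _).trans (by gcongr)
    _ = _ := (mul_assoc _ _ _).symm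

/-- Variant of `exists_approximation_of_wellPosed` for norms given by `NormedSpace.Core`. -/
theorem exists_approximation_of_wellPosed_of_core {P E₀ F₀ : Type*} {X Y : P → Type*}
    [TopologicalSpace P] [CompactSpace P]
    [AddCommGroup E₀] [Module ℝ E₀] [Norm E₀] (hE₀ : NormedSpace.Core ℝ E₀)
    [AddCommGroup F₀] [Module ℝ F₀] [Norm F₀] (hF₀ : NormedSpace.Core ℝ F₀)
    [∀ μ, NormedAddCommGroup (X μ)] [∀ μ, NormedSpace ℝ (X μ)] [∀ μ, CompleteSpace (X μ)]
    [∀ μ, NormedAddCommGroup (Y μ)] [∀ μ, NormedSpace ℝ (Y μ)]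
    (j : ∀ μ, E₀ →ₗ[ℝ] X μ) (hj : ∀ μ, DenseRange (j μ))
    {cX CX : ℝ} (hcX : 0 < cX) (hCX : 0 < CX)
    (hjX : ∀ μ u, cX * ‖u‖ ≤ ‖j μ u‖ ∧ ‖j μ u‖ ≤ CX * ‖u‖)
    (k : ∀ μ, F₀ →ₗ[ℝ] Y μ) (hk : ∀ μ, DenseRange (k μ))
    {cY CY : ℝ} (hcY : 0 < cY)
    (hkY : ∀ μ v, cY * ‖v‖ ≤ ‖k μ v‖ ∧ ‖k μ v‖ ≤ CY * ‖v‖)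
    (b : ∀ μ, X μ →L[ℝ] Y μ →L[ℝ] ℝ) (f : ∀ μ, Y μ →L[ℝ] ℝ) (hwp : ∀ μ, WellPosed (b μ))
    (σ : ∀ μ, X μ) (hσ : ∀ μ v, b μ (σ μ) v = f μ v)
    {ι κ : Type*} [Fintype ι] [Fintype κ]
    {θ : ι → P → ℝ} (hθ : ∀ i, Continuous (θ i)) {η : κ → P → ℝ} (hη : ∀ l, Continuous (η l))
    (b₀ : ι → E₀ →ₗ[ℝ] F₀ →ₗ[ℝ] ℝ) (hb₀ : ∀ i, ∃ K : ℝ, ∀ u v, |b₀ i u v| ≤ K * ‖u‖ * ‖v‖)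
    (f₀ : κ → F₀ →ₗ[ℝ] ℝ) (hf₀ : ∀ l, ∃ K : ℝ, ∀ v, |f₀ l v| ≤ K * ‖v‖)
    (hb : ∀ μ u v, b μ (j μ u) (k μ v) = ∑ i, θ i μ * b₀ i u v)
    (hf : ∀ μ v, f μ (k μ v) = ∑ l, η l μ * f₀ l v) :
    ∃ (J : ℕ) (C : ℝ), 0 < J ∧ 0 < C ∧ ∀ M : ℕ, ∃ S : Submodule ℝ E₀,
      Module.rank ℝ S ≤ ((J * M ^ Fintype.card ι : ℕ) : Cardinal) ∧
      ∀ μ, ∃ s ∈ S, ‖σ μ - j μ s‖ ≤ C * (1 / 2) ^ M := by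
  -- These instances are built over the given group and module structures, so the linear maps keep
  -- their types.
  let := NormedAddCommGroup.ofCore hE₀
  let := NormedSpace.ofCore hE₀
  let := NormedAddCommGroup.ofCore hF₀
  let := NormedSpace.ofCore hF₀
  exact exists_approximation_of_wellPosed j hj hcX hCX hjX k hk hcY hkY b f hwp σ hσ hθ hη
    b₀ hb₀ f₀ hf₀ hb hf

/-! ### Constant sections and the width -/

/-- The realisations in `X μ` of the elements of a dense intersection are dense. -/
theorem DenseIntersection.denseRange {P : Type*} {X : P → Type*} {V : Type*}
    [∀ μ, NormedAddCommGroup (X μ)] [∀ μ, NormedSpace ℝ (X μ)] [AddCommGroup V] [Module ℝ V]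
    {ι : ∀ μ, X μ →ₗ[ℝ] V} (h : DenseIntersection ι) (hι : ∀ μ, Function.Injective (ι μ)) (μ : P) :
    DenseRange (LinearMap.proj μ ∘ₗ constantSection ι hι) :=
  (h μ).mono fun x hx => ⟨⟨ι μ x, hx⟩, hι μ (apply_constantSection ι hι ⟨ι μ x, hx⟩ μ)⟩

theorem mainTheorem1
    {P : Type*} [TopologicalSpace P] [CompactSpace P]
    {V W : Type*} [AddCommGroup V] [Module ℝ V] [AddCommGroup W] [Module ℝ W]
    {X Y : P → Type*}
    [∀ μ, NormedAddCommGroup (X μ)] [∀ μ, NormedSpace ℝ (X μ)] [∀ μ, CompleteSpace (X μ)]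
    [∀ μ, NormedAddCommGroup (Y μ)] [∀ μ, NormedSpace ℝ (Y μ)] [∀ μ, CompleteSpace (Y μ)]
    -- the inclusions `X μ ⊆ V` and `Y μ ⊆ W`
    (ιX : ∀ μ, X μ →ₗ[ℝ] V) (hιX : ∀ μ, Function.Injective (ιX μ))
    (ιY : ∀ μ, Y μ →ₗ[ℝ] W) (hιY : ∀ μ, Function.Injective (ιY μ))
    -- the well-posed problem and its solution section
    (b : ∀ μ, X μ →L[ℝ] Y μ →L[ℝ] ℝ) (f : ∀ μ, Y μ →L[ℝ] ℝ)
    (hwp : ∀ μ, WellPosed (b μ))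
    (σsol : ∀ μ, X μ) (hsol : ∀ μ, ∀ v : Y μ, b μ (σsol μ) v = f μ v)
    -- denseness
    (hD1 : DenseIntersection ιX) (hD2 : DenseIntersection ιY)
    -- parameter-independent norms on the intersection spaces
    [Norm (intersectionSpace ιX)] (hnX : NormedSpace.Core ℝ (intersectionSpace ιX))
    [Norm (intersectionSpace ιY)] (hnY : NormedSpace.Core ℝ (intersectionSpace ιY))
    (cX CX cY CY : ℝ) (hcX : 0 < cX) (hCX : 0 < CX) (hcY : 0 < cY) (hCY : 0 < CY)
    (hX : ∀ (u : intersectionSpace ιX) (μ : P),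
      cX * ‖u‖ ≤ ‖constantSection ιX hιX u μ‖ ∧ ‖constantSection ιX hιX u μ‖ ≤ CX * ‖u‖)
    (hY : ∀ (v : intersectionSpace ιY) (μ : P),
      cY * ‖v‖ ≤ ‖constantSection ιY hιY v μ‖ ∧ ‖constantSection ιY hιY v μ‖ ≤ CY * ‖v‖)
    -- parameter-separability, with continuous (bi)linear forms on the intersection spaces
    (Qb Qf : ℕ) (hQb : 1 ≤ Qb)
    (θb : Fin Qb → P → ℝ) (hθb : ∀ i, Continuous (θb i))
    (θf : Fin Qf → P → ℝ) (hθf : ∀ i, Continuous (θf i))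
    (b₀ : Fin Qb → intersectionSpace ιX →ₗ[ℝ] intersectionSpace ιY →ₗ[ℝ] ℝ)
    (hb₀ : ∀ i, ∃ K : ℝ, ∀ u v, |b₀ i u v| ≤ K * ‖u‖ * ‖v‖)
    (f₀ : Fin Qf → intersectionSpace ιY →ₗ[ℝ] ℝ)
    (hf₀ : ∀ i, ∃ K : ℝ, ∀ v, |f₀ i v| ≤ K * ‖v‖)
    (hb : ∀ (μ : P) (u : intersectionSpace ιX) (v : intersectionSpace ιY),
      b μ (constantSection ιX hιX u μ) (constantSection ιY hιY v μ) =
        ∑ i, θb i μ * b₀ i u v)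
    (hf : ∀ (μ : P) (v : intersectionSpace ιY),
      f μ (constantSection ιY hιY v μ) = ∑ i, θf i μ * f₀ i v) :
    ∃ α β : ℝ, 0 < α ∧ 0 < β ∧ ∀ N : ℕ,
      sectionalWidth (constantSections ιX hιX) N σsol ≤
        ENNReal.ofReal (α * Real.exp (-β * (N : ℝ) ^ (1 / (Qb : ℝ)))) := by
  let jX : ∀ μ, intersectionSpace ιX →ₗ[ℝ] X μ := fun μ =>
    LinearMap.proj μ ∘ₗ constantSection ιX hιX
  let jY : ∀ μ, intersectionSpace ιY →ₗ[ℝ] Y μ := fun μ =>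
    LinearMap.proj μ ∘ₗ constantSection ιY hιY
  have hjX : ∀ μ u, cX * ‖u‖ ≤ ‖jX μ u‖ ∧ ‖jX μ u‖ ≤ CX * ‖u‖ := fun μ u => hX u μ
  have hjY : ∀ μ v, cY * ‖v‖ ≤ ‖jY μ v‖ ∧ ‖jY μ v‖ ≤ CY * ‖v‖ := fun μ v => hY v μ
  have hjXd : ∀ μ, DenseRange (jX μ) := hD1.denseRange hιX
  have hjYd : ∀ μ, DenseRange (jY μ) := hD2.denseRange hιY
  have hb' : ∀ μ u v, b μ (jX μ u) (jY μ v) = ∑ i, θb i μ * b₀ i u v := hb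
  have hf' : ∀ μ v, f μ (jY μ v) = ∑ l, θf l μ * f₀ l v := hf
  obtain ⟨J, C, hJ, hC, h⟩ := exists_approximation_of_wellPosed_of_core (X := X) (Y := Y)
    hnX hnY jX hjXd hcX hCX hjX jY hjYd hcY hjY b f hwp σsol hsol hθb hθf b₀ hb₀ f₀ hf₀ hb' hf'
  rw [Fintype.card_fin] at h
  obtain ⟨β, hβ, hM⟩ := exists_mul_pow_le_and_half_pow_le hQb hJ
  refine ⟨C * 2, β, by positivity, hβ, fun N => ?_⟩
  obtain ⟨M, hMN, hMβ⟩ := hM N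
  obtain ⟨S, hS, hS'⟩ := h M
  -- The competitor in the infimum is the space of constant sections with values in `S`.
  refine iInf₂_le_of_le (S.map (constantSection ιX hιX)) LinearMap.map_le_range
    (iInf_le_of_le ?_ (iSup_le fun μ => ?_))
  -- Lifts appear because the intersection space and the space of sections may lie in different
  -- universes.
  · have := (lift_rank_map_le (constantSection ιX hιX) S).trans
      (Cardinal.lift_le.2 (hS.trans (Nat.cast_le.2 hMN)))
    simpa using this
  · obtain ⟨s, hs, hsμ⟩ := hS' μ
    refine iInf₂_le_of_le _ (Submodule.mem_map_of_mem hs) ?_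
    rw [← ofReal_norm]
    refine ENNReal.ofReal_le_ofReal (hsμ.trans ?_)
    rw [mul_assoc]
    gcongr
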